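/- Let $d,m,n$ be nonnegative integers with $d>mn$, let $\Theta\subseteq\mathbb R^d$ and $\mathcal Y\subseteq\mathbb R^m$ be measurable, let $\mathcal X$ be a set, and let $f:\mathcal X\times\Theta\to\mathcal Y$ be such that each $f(a,\cdot)$ is $\mathcal C^\infty$ in an open set containing $\Theta$. Let $\ell:\mathcal Y\times\mathcal Y\to[0,\infty)$ be continuous (for instance, smooth) and let $\gamma>0$ be such that $\int_{\mathcal Y}e^{-\ell(u,v)/\gamma}\,dv<\infty$ for all $u\in\mathcal Y$; the Gibbs likelihood of an outcome $v\in\mathcal Y$ at an input $a$ is $$p_\gamma(v\mid\theta,a)=\frac{e^{-\ell(f(a,\theta),v)/\gamma}}{\int_{\mathcal Y}e^{-\ell(f(a,\theta),v')/\gamma}\,dv'} .$$ Let $\pi$ be a probability density on $\Theta$, and fix inputs $x_1,\dots,x_n\in\mathcal X$. Put $F(\theta)=(f(x_i,\theta))_{i=1}^n\in\mathbb R^{n\times m}\cong\mathbb R^{mn}$, let $DF(\theta)\in\mathbb R^{mn\times d}$ be its Jacobian matrix, $J(\theta)=DF(\theta)DF(\theta)^\top$, and, for $y,z\in\mathcal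 Y^n$, $$L(z,y)=\sum_{i=1}^n\ell(z_i,y_i),\qquad c_{n,\gamma}(z)^{-1}=\prod_{i=1}^n\int_{\mathcal Y}e^{-\ell(z_i,v)/\gamma}\,dv,\qquad p_{n,\gamma}(y\mid\theta,x)=\prod_{i=1}^n p_\gamma(y_i\mid\theta,x_i).$$ Assume that $\int_\Theta \pi(\theta)\det J(\theta)^{-1/2}\,d\theta<\infty$, where $t/0=\infty$ for $t>0$ and $0/0=0$; in particular $\det J>0$ almost everywhere on $\{\pi>0\}$. Define the dual likelihood and the dual prior by $$p^\star_{n,\gamma}(y\mid z)=c_{n,\gamma}(z)\,e^{-L(z,y)/\gamma},\qquad \pi^\star(z)=\int_{F^{-1}(z)}\frac{\pi(\theta)}{\det J(\theta)^{1/2}}\,d\mathcal H^{d-mn}(\theta),$$ where $F^{-1}(z)=\{\theta\in\Theta:F(\theta)=z\}$, $z\in\mathbb R^{mn}$, and $\mathcal H^{k}$ is $k$-dimensional Hausdorff measure, normalized to agree with Lebesgue measure on $\mathbb R^k$. Then: 1. $\pi^\star$ is a probability density on $\mathbb R^{mn}$; 2. for every $z\in\mathcal Y^n$, $y\mapsto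 p^\star_{n,\gamma}(y\mid z)$ is a probability density on $\mathcal Y^n$; 3. for every $y\in\mathcal Y^n$ the marginal likelihoods of the two models coincide (as elements of $[0,\infty]$): $$\int_\Theta p_{n,\gamma}(y\mid\theta,x)\,\pi(\theta)\,d\theta=\int_{\mathbb R^{mn}}p^\star_{n,\gamma}(y\mid z)\,\pi^\star(z)\,dz ,$$ where the integrand on the right is $0$ for $z\notin\mathcal Y^n$, since $\pi^\star(z)=0$ there. -/

import Mathlib

open MeasureTheory
open scoped ENNReal ContDiff

noncomputable section

namespace BayesianDuality

/-- `g` is a probability density with respect to `μ`. Densities take values in `[0, ∞]`; a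
probability density is automatically finite almost everywhere. -/
def IsProbDensity {α : Type*} [MeasurableSpace α] (μ : Measure α) (g : α → ℝ≥0∞) : Prop :=
  AEMeasurable g μ ∧ ∫⁻ a, g a ∂μ = 1

/-- `h` is smooth on the arbitrary set `S`: it is `C^∞` in an open set containing `S`. -/
def SmoothNear {E G : Type*} [NormedAddCommGroup E] [NormedSpace ℝ E] [NormedAddCommGroup G]
    [NormedSpace ℝ G] (h : E → G) (S : Set E) : Prop :=
  ∃ U : Set E, IsOpen U ∧ S ⊆ U ∧ ContDiffOn ℝ ∞ h U

variable {X : Type*} {m n d : ℕ}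

/-- The map `F(θ) = (f(x_i, θ))_i`. The space `ℝ^{n × m} = ℝ^{mn}` is `Fin n → EuclideanSpace ℝ (Fin m)`,
an element being the family of its `n` rows, with its product (Lebesgue) measure. -/
def dataMap (f : X → EuclideanSpace ℝ (Fin d) → EuclideanSpace ℝ (Fin m)) (x : Fin n → X)
    (θ : EuclideanSpace ℝ (Fin d)) : Fin n → EuclideanSpace ℝ (Fin m) :=
  fun i => f (x i) θ

/-- The Jacobian matrix `DF(θ)`, of size `mn × d`, with entries `∂ F_{ij} / ∂ θ_k`. -/
def jacobianMatrix (F : EuclideanSpace ℝ (Fin d) → Fin n → EuclideanSpace ℝ (Fin m))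
    (θ : EuclideanSpace ℝ (Fin d)) : Matrix (Fin n × Fin m) (Fin d) ℝ :=
  Matrix.of fun ij k => (fderiv ℝ F θ (EuclideanSpace.single k 1)) ij.1 ij.2

/-- `J(θ) = DF(θ) DF(θ)ᵀ`. -/
def gramMatrix (F : EuclideanSpace ℝ (Fin d) → Fin n → EuclideanSpace ℝ (Fin m))
    (θ : EuclideanSpace ℝ (Fin d)) : Matrix (Fin n × Fin m) (Fin n × Fin m) ℝ :=
  jacobianMatrix F θ * (jacobianMatrix F θ).transpose

/-- `π(θ) / det J(θ)^{1/2}` with values in `[0, ∞]`: where `det J(θ) = 0` the value is `∞` if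
`π(θ) > 0`, and `0` if `π(θ) = 0`. -/
def weightedPrior (F : EuclideanSpace ℝ (Fin d) → Fin n → EuclideanSpace ℝ (Fin m))
    (π : EuclideanSpace ℝ (Fin d) → ℝ) (θ : EuclideanSpace ℝ (Fin d)) : ℝ≥0∞ :=
  ENNReal.ofReal (π θ) / ENNReal.ofReal (gramMatrix F θ).det ^ (1 / 2 : ℝ)

/-- The normalizing integral `∫_𝒴 exp(-ℓ(u, v) / γ) dv` of the Gibbs likelihood. -/
def gibbsIntegral (Y : Set (EuclideanSpace ℝ (Fin m)))
    (ℓ : EuclideanSpace ℝ (Fin m) → EuclideanSpace ℝ (Fin m) → ℝ) (γ : ℝ)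
    (u : EuclideanSpace ℝ (Fin m)) : ℝ≥0∞ :=
  ∫⁻ v in Y, ENNReal.ofReal (Real.exp (-(1 / γ) * ℓ u v))

/-- The Gibbs likelihood of the outcome `v` given the prediction `u`. -/
def gibbsLikelihood (Y : Set (EuclideanSpace ℝ (Fin m)))
    (ℓ : EuclideanSpace ℝ (Fin m) → EuclideanSpace ℝ (Fin m) → ℝ) (γ : ℝ)
    (u v : EuclideanSpace ℝ (Fin m)) : ℝ≥0∞ :=
  ENNReal.ofReal (Real.exp (-(1 / γ) * ℓ u v)) / gibbsIntegral Y ℓ γ u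

/-- The likelihood `p_{n,γ}(y | θ, x) = ∏ i, p_γ(y_i | θ, x_i)`. -/
def likelihood (Y : Set (EuclideanSpace ℝ (Fin m)))
    (ℓ : EuclideanSpace ℝ (Fin m) → EuclideanSpace ℝ (Fin m) → ℝ) (γ : ℝ)
    (f : X → EuclideanSpace ℝ (Fin d) → EuclideanSpace ℝ (Fin m)) (x : Fin n → X)
    (y : Fin n → EuclideanSpace ℝ (Fin m)) (θ : EuclideanSpace ℝ (Fin d)) : ℝ≥0∞ :=
  ∏ i, gibbsLikelihood Y ℓ γ (f (x i) θ) (y i)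

/-- The marginal likelihood `∫_Θ p_{n,γ}(y | θ, x) π(θ) dθ`. -/
def marginalLikelihood (Θ : Set (EuclideanSpace ℝ (Fin d))) (Y : Set (EuclideanSpace ℝ (Fin m)))
    (ℓ : EuclideanSpace ℝ (Fin m) → EuclideanSpace ℝ (Fin m) → ℝ) (γ : ℝ)
    (f : X → EuclideanSpace ℝ (Fin d) → EuclideanSpace ℝ (Fin m)) (x : Fin n → X)
    (π : EuclideanSpace ℝ (Fin d) → ℝ) (y : Fin n → EuclideanSpace ℝ (Fin m)) : ℝ≥0∞ :=
  ∫⁻ θ in Θ, likelihood Y ℓ γ f x y θ * ENNReal.ofReal (π θ)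

/-- The total loss `L(z, y) = ∑ i, ℓ(z_i, y_i)`. -/
def totalLoss (ℓ : EuclideanSpace ℝ (Fin m) → EuclideanSpace ℝ (Fin m) → ℝ)
    (z y : Fin n → EuclideanSpace ℝ (Fin m)) : ℝ :=
  ∑ i, ℓ (z i) (y i)

/-- `c_{n,γ}(z)`, where `c_{n,γ}(z)⁻¹ = ∏ i, ∫_𝒴 exp(-ℓ(z_i, v) / γ) dv`. -/
def normConst (Y : Set (EuclideanSpace ℝ (Fin m)))
    (ℓ : EuclideanSpace ℝ (Fin m) → EuclideanSpace ℝ (Fin m) → ℝ) (γ : ℝ)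
    (z : Fin n → EuclideanSpace ℝ (Fin m)) : ℝ≥0∞ :=
  (∏ i, gibbsIntegral Y ℓ γ (z i))⁻¹

/-- The dual likelihood `p*_{n,γ}(y | z) = c_{n,γ}(z) exp(-L(z, y) / γ)`. -/
def dualLikelihood (Y : Set (EuclideanSpace ℝ (Fin m)))
    (ℓ : EuclideanSpace ℝ (Fin m) → EuclideanSpace ℝ (Fin m) → ℝ) (γ : ℝ)
    (y z : Fin n → EuclideanSpace ℝ (Fin m)) : ℝ≥0∞ :=
  normConst Y ℓ γ z * ENNReal.ofReal (Real.exp (-(1 / γ) * totalLoss ℓ z y))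

/-- The dual prior `π*(z) = ∫_{F⁻¹(z)} π(θ) / det J(θ)^{1/2} dℋ^{d-mn}(θ)`, with
`F⁻¹(z) = {θ ∈ Θ | F(θ) = z}` and the Hausdorff measure normalized as usual, so that `ℋ^k` is
Lebesgue measure on `ℝ^k`. -/
def dualPrior (Θ : Set (EuclideanSpace ℝ (Fin d)))
    (F : EuclideanSpace ℝ (Fin d) → Fin n → EuclideanSpace ℝ (Fin m))
    (π : EuclideanSpace ℝ (Fin d) → ℝ) (z : Fin n → EuclideanSpace ℝ (Fin m)) : ℝ≥0∞ :=
  ∫⁻ θ in {θ | θ ∈ Θ ∧ F θ = z}, weightedPrior F π θ ∂(Measure.euclideanHausdorffMeasure (d - m * n))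

/-- The marginal likelihood `∫_{ℝ^{mn}} p*(y | z) π*(z) dz` of the dual model. -/
def dualMarginalLikelihood (Θ : Set (EuclideanSpace ℝ (Fin d)))
    (Y : Set (EuclideanSpace ℝ (Fin m)))
    (ℓ : EuclideanSpace ℝ (Fin m) → EuclideanSpace ℝ (Fin m) → ℝ) (γ : ℝ)
    (F : EuclideanSpace ℝ (Fin d) → Fin n → EuclideanSpace ℝ (Fin m))
    (π : EuclideanSpace ℝ (Fin d) → ℝ) (y : Fin n → EuclideanSpace ℝ (Fin m)) : ℝ≥0∞ :=
  ∫⁻ z, dualLikelihood Y ℓ γ y z * dualPrior Θ F π z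

end BayesianDuality

end

/-! The dual prior is the density of the image of `π dθ` under `F`. On the regular set `R = {det J >
0}` in `Θ`, the coarea formula says that integrating `g` over the fibers of `F` and then over `z`
gives `∫_R g √det J`. With `g = ψ(F) π / √det J` this yields `∫ ψ π* = ∫_Θ ψ(F) π` for all
measurable `ψ ≥ 0` (`dualPrior_spec`). Taking `ψ = 1` shows that `π*` has mass one. Taking for `ψ`
the dual likelihood cut off to `𝒴ⁿ` equates the marginals, since the likelihood depends on `θ` only
through `F θ`. The dual likelihood is normalized by Tonelli, once its normalizers are known to be
nonzero.

Coarea: near a regular point `θ₀`, complete `F` by a linear map `P`, the adjoint of an isometric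
parametrization of `ker DF(θ₀)`. The Jacobian of `(F, P)` at `θ₀` is exactly `√det J(θ₀)`, and `P`
preserves lengths along the kernel. Nearby both hold up to a factor `t > 1`, so change of variables
and Tonelli give the formula up to powers of `t` (`exists_fiber_integral_approx`); a countable
partition and `t → 1` finish (`coarea`).

Critical points: finiteness of `∫ π / √det J` makes the critical points with `π > 0` a null set.
Almost every fiber meets a null set in an `ℋ^{d-mn}`-null set (`ae_fiber_null`), so these points do
not affect `π*`. -/

noncomputable section

namespace BayesianDuality

open Set Filter Topology
open scoped NNReal Matrix

/-! ### Linear algebra: completing a surjective linear map to a square one. -/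

section LinearAlgebra

variable {ι κ : Type*} [Fintype ι] [Fintype κ] {k : ℕ}

/-- The matrix of a linear map `ℝ^κ → ℝ^ι` in the standard bases. -/
def stdMatrix [DecidableEq κ] (A : EuclideanSpace ℝ κ →L[ℝ] (ι → ℝ)) : Matrix ι κ ℝ :=
  Matrix.of fun i j => A (EuclideanSpace.single j 1) i

/-- The Jacobian `√det(A Aᵀ)` of a linear map `A : ℝ^κ → ℝ^ι`. -/
def coareaFactor [DecidableEq ι] [DecidableEq κ] (A : EuclideanSpace ℝ κ →L[ℝ] (ι → ℝ)) : ℝ :=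
  √(stdMatrix A * (stdMatrix A)ᵀ).det

theorem stdMatrix_mulVec {ι κ : Type*} [Fintype κ] [DecidableEq κ]
    (A : EuclideanSpace ℝ κ →L[ℝ] (ι → ℝ))
    (v : EuclideanSpace ℝ κ) : stdMatrix A *ᵥ v.ofLp = A v := by
  have h : v = ∑ j, v j • EuclideanSpace.single j (1 : ℝ) := by
    ext i
    simp [Finset.sum_apply, Pi.single_apply]
  ext i
  conv_rhs => rw [h]
  simp [stdMatrix, Matrix.mulVec, dotProduct, mul_comm]

theorem surjective_of_det_ne_zero [DecidableEq ι] [DecidableEq κ]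
    {A : EuclideanSpace ℝ κ →L[ℝ] (ι → ℝ)}
    (hA : (stdMatrix A * (stdMatrix A)ᵀ).det ≠ 0) : Function.Surjective A := by
  intro y
  refine ⟨WithLp.toLp 2 ((stdMatrix A)ᵀ *ᵥ ((stdMatrix A * (stdMatrix A)ᵀ)⁻¹ *ᵥ y)), ?_⟩
  rw [← stdMatrix_mulVec]
  simp only [Matrix.mulVec_mulVec]
  rw [← Matrix.mul_assoc, Matrix.mul_nonsing_inv _ (isUnit_iff_ne_zero.2 hA), Matrix.one_mulVec]

theorem exists_isometry_onto_ker {A : EuclideanSpace ℝ κ →L[ℝ] (ι → ℝ)}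
    (hA : Function.Surjective A) (hk : Fintype.card κ = Fintype.card ι + k) :
    ∃ Q : EuclideanSpace ℝ (Fin k) →ₗᵢ[ℝ] EuclideanSpace ℝ κ,
      LinearMap.range Q.toLinearMap = LinearMap.ker (A : EuclideanSpace ℝ κ →ₗ[ℝ] (ι → ℝ)) := by
  set A' : EuclideanSpace ℝ κ →ₗ[ℝ] (ι → ℝ) := A.toLinearMap
  have h1 := LinearMap.finrank_range_add_finrank_ker A'
  have h2 : LinearMap.range A' = ⊤ := LinearMap.range_eq_top.2 hA
  rw [h2, finrank_top, Module.finrank_pi, finrank_euclideanSpace, hk] at h1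
  have h3 : Module.finrank ℝ (LinearMap.ker A') = k := by omega
  let b := (stdOrthonormalBasis ℝ (LinearMap.ker A')).reindex (finCongr h3)
  refine ⟨(LinearMap.ker A').subtypeₗᵢ.comp b.repr.symm.toLinearIsometry, ?_⟩
  ext v
  simp only [LinearMap.mem_range]
  constructor
  · rintro ⟨w, rfl⟩
    exact (b.repr.symm w).2
  · intro hv
    exact ⟨b.repr ⟨v, hv⟩, by simp⟩

/-- If `v` is nearly in the kernel of `A`, then its projection to the kernel has almost the
same length as `v`. -/
theorem exists_norm_le_of_nearly_ker {A : EuclideanSpace ℝ κ →L[ℝ] (ι → ℝ)}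
    {Q : EuclideanSpace ℝ (Fin k) →ₗᵢ[ℝ] EuclideanSpace ℝ κ}
    (hQ : LinearMap.range Q.toLinearMap = LinearMap.ker (A : EuclideanSpace ℝ κ →ₗ[ℝ] (ι → ℝ)))
    {t : ℝ} (ht : 1 < t) :
    ∃ c : ℝ, 0 < c ∧ ∀ v, ‖A v‖ ≤ c * ‖v‖ →
      ‖v‖ ≤ t * ‖ContinuousLinearMap.adjoint Q.toContinuousLinearMap v‖ := by
  set A' : EuclideanSpace ℝ κ →ₗ[ℝ] (ι → ℝ) := A.toLinearMap
  set P := ContinuousLinearMap.adjoint Q.toContinuousLinearMap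
  let R := A'.domRestrict (LinearMap.ker A')ᗮ
  have hR : LinearMap.ker R = ⊥ := by
    refine LinearMap.ker_eq_bot'.2 fun v hv => ?_
    have h1 : (v : EuclideanSpace ℝ κ) ∈ LinearMap.ker A' := hv
    have h2 : inner ℝ (v : EuclideanSpace ℝ κ) (v : EuclideanSpace ℝ κ) = 0 := v.2 _ h1
    exact Subtype.ext (inner_self_eq_zero.1 h2)
  obtain ⟨K, hK, hKR⟩ := LinearMap.exists_antilipschitzWith R hR
  have hK' : (0 : ℝ) < K := hK
  -- `K` bounds the component of `v` orthogonal to the kernel by `K ‖A v‖`. The constant below makes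
  -- this at most `(1 - 1/t) ‖v‖`, leaving at least `‖v‖ / t` for the kernel component.
  have ht0 : 0 < t := by linarith
  refine ⟨(1 - 1 / t) / K, div_pos (sub_pos.2 ((div_lt_one ht0).2 ht)) hK', fun v hv => ?_⟩
  have hPQ : ∀ w, P (Q w) = w := by
    intro w
    refine ext_inner_left ℝ fun u => ?_
    rw [ContinuousLinearMap.adjoint_inner_right]
    exact Q.inner_map_map u w
  have hAQ : ∀ w, A (Q w) = 0 := by
    intro w
    have : Q w ∈ LinearMap.ker A' := hQ ▸ ⟨w, rfl⟩
    exact this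
  have hw : v - Q (P v) ∈ (LinearMap.ker A')ᗮ := by
    rw [← hQ]
    rintro _ ⟨w, rfl⟩
    have : inner ℝ (Q w) (v - Q (P v)) = inner ℝ w (P (v - Q (P v))) :=
      (ContinuousLinearMap.adjoint_inner_right Q.toContinuousLinearMap w _).symm
    change inner ℝ (Q w) (v - Q (P v)) = 0
    rw [this, map_sub, hPQ, sub_self, inner_zero_right]
  have h1 : ‖v - Q (P v)‖ ≤ K * ‖A v‖ := by
    have := hKR.le_mul_dist ⟨_, hw⟩ 0
    rw [dist_zero_right, map_zero, dist_zero_right] at this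
    have h2 : R ⟨_, hw⟩ = A v := by
      change A (v - Q (P v)) = A v
      rw [map_sub, hAQ, sub_zero]
    rwa [h2] at this
  have h2 : ‖v‖ ≤ ‖P v‖ + (1 - 1 / t) * ‖v‖ := by
    calc ‖v‖ = ‖Q (P v) + (v - Q (P v))‖ := by rw [add_sub_cancel]
      _ ≤ ‖Q (P v)‖ + ‖v - Q (P v)‖ := norm_add_le _ _
      _ ≤ ‖P v‖ + K * ((1 - 1 / t) / K * ‖v‖) := by
          rw [Q.norm_map]
          gcongr
          exact h1.trans (by gcongr)
      _ = ‖P v‖ + (1 - 1 / t) * ‖v‖ := by field_simp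
  have h3 : ‖v‖ / t ≤ ‖P v‖ := by
    have : ‖v‖ / t = 1 / t * ‖v‖ := by ring
    linarith
  rw [div_le_iff₀ ht0] at h3
  linarith

/-- The identification of `ℝ^ι × ℝ^k` with `ℝ^κ` given by a bijection of coordinates. -/
def glue (σ : κ ≃ ι ⊕ Fin k) : (ι → ℝ) × EuclideanSpace ℝ (Fin k) →L[ℝ] EuclideanSpace ℝ κ :=
  LinearMap.toContinuousLinearMap
    { toFun := fun p => WithLp.toLp 2 fun j => Sum.elim p.1 p.2.ofLp (σ j)
      map_add' := by
        intro p q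
        ext j
        rcases h : σ j <;> simp [h]
      map_smul' := by
        intro c p
        ext j
        rcases h : σ j <;> simp [h] }

theorem glue_apply (σ : κ ≃ ι ⊕ Fin k) (p : (ι → ℝ) × EuclideanSpace ℝ (Fin k)) (j : κ) :
    glue σ p j = Sum.elim p.1 p.2.ofLp (σ j) := rfl

theorem glue_injective (σ : κ ≃ ι ⊕ Fin k) : Function.Injective (glue σ) := by
  intro p q h
  have h' : ∀ a, Sum.elim p.1 p.2.ofLp a = Sum.elim q.1 q.2.ofLp a := by
    intro a
    have := congrArg (fun v : EuclideanSpace ℝ κ => v (σ.symm a)) h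
    simpa [glue_apply] using this
  refine Prod.ext (funext fun i => h' (Sum.inl i)) ?_
  ext i
  exact h' (Sum.inr i)

theorem measurePreserving_glue (σ : κ ≃ ι ⊕ Fin k) : MeasurePreserving (glue σ) := by
  have h1 : MeasurePreserving (Prod.map id (WithLp.ofLp (p := 2)) :
      (ι → ℝ) × EuclideanSpace ℝ (Fin k) → (ι → ℝ) × (Fin k → ℝ)) :=
    (MeasurePreserving.id _).prod (PiLp.volume_preserving_ofLp _)
  have h2 := volume_measurePreserving_sumPiEquivProdPi_symm (fun _ : ι ⊕ Fin k => ℝ)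
  have h3 := volume_measurePreserving_piCongrLeft (fun _ : κ => ℝ) σ.symm
  have h4 := PiLp.volume_preserving_toLp κ
  have h := h4.comp (h3.comp (h2.comp h1))
  convert h using 1
  funext p
  ext j
  rw [glue_apply]
  simp only [Function.comp_apply]
  obtain ⟨a, rfl⟩ := σ.symm.surjective j
  simp only [MeasurableEquiv.coe_piCongrLeft, Equiv.piCongrLeft_apply_apply]
  rcases a with a | a <;> simp <;> rfl

/-- Stack the rows of `A` over those of `Qᵀ` to get a square matrix `M`. Since `A Q = 0` and `Qᵀ Q =
1`, the product `M Mᵀ` is block diagonal with blocks `A Aᵀ` and `1`, up to the reindexing `σ`. -/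
theorem det_glue_sq [DecidableEq ι] [DecidableEq κ] (σ : κ ≃ ι ⊕ Fin k)
    {A : EuclideanSpace ℝ κ →L[ℝ] (ι → ℝ)}
    {Q : EuclideanSpace ℝ (Fin k) →ₗᵢ[ℝ] EuclideanSpace ℝ κ}
    (hQ : ∀ w, A (Q w) = 0) :
    ((glue σ).comp (A.prod (ContinuousLinearMap.adjoint Q.toContinuousLinearMap))).det ^ 2 =
      (stdMatrix A * (stdMatrix A)ᵀ).det := by
  set P := ContinuousLinearMap.adjoint Q.toContinuousLinearMap
  let q : Matrix κ (Fin k) ℝ := Matrix.of fun j l => Q (EuclideanSpace.single l 1) j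
  have hP : ∀ j l, P (EuclideanSpace.single j 1) l = q j l := by
    intro j l
    have h := ContinuousLinearMap.adjoint_inner_right Q.toContinuousLinearMap
      (EuclideanSpace.single l 1) (EuclideanSpace.single j (1 : ℝ))
    rw [EuclideanSpace.inner_single_left, EuclideanSpace.inner_single_right] at h
    simpa [q] using h
  have hAq : stdMatrix A * q = 0 := by
    ext i l
    have h := congrFun ((stdMatrix_mulVec A (Q (EuclideanSpace.single l 1))).trans (hQ _)) i
    simpa [Matrix.mul_apply, Matrix.mulVec, dotProduct, q] using h
  have hqq : qᵀ * q = 1 := by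
    ext l l'
    have h := Q.inner_map_map (EuclideanSpace.single l 1) (EuclideanSpace.single l' (1 : ℝ))
    rw [EuclideanSpace.inner_single_left, PiLp.inner_apply] at h
    simp only [Matrix.mul_apply, Matrix.transpose_apply, q, Matrix.of_apply]
    simp only [RCLike.inner_apply, conj_trivial, one_mul] at h
    rw [Matrix.one_apply]
    simp only [mul_comm (Q (EuclideanSpace.single l 1) _)]
    rw [h]
    simp
  let M : Matrix κ κ ℝ := (Matrix.fromRows (stdMatrix A) qᵀ).submatrix σ id
  have hM : ((glue σ).comp (A.prod P)).det = M.det := by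
    rw [ContinuousLinearMap.det,
      ← LinearMap.det_toMatrix (EuclideanSpace.basisFun κ ℝ).toBasis]
    congr 1
    ext i j
    rw [LinearMap.toMatrix_apply]
    simp only [OrthonormalBasis.coe_toBasis, EuclideanSpace.basisFun_apply,
      OrthonormalBasis.coe_toBasis_repr_apply, EuclideanSpace.basisFun_repr]
    change glue σ (A (EuclideanSpace.single j 1), P (EuclideanSpace.single j 1)) i = _
    rw [glue_apply]
    simp only [M, Matrix.submatrix_apply, id]
    rcases σ i with a | a
    · simp [stdMatrix]
    · simp [hP]
  have hMM : M * Mᵀ = (Matrix.fromBlocks (stdMatrix A * (stdMatrix A)ᵀ) 0 0 1).submatrix σ σ := by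
    have : M * Mᵀ = (Matrix.fromRows (stdMatrix A) qᵀ *
        (Matrix.fromRows (stdMatrix A) qᵀ)ᵀ).submatrix σ σ := by
      ext i j
      rfl
    rw [this, Matrix.transpose_fromRows, Matrix.fromRows_mul_fromCols, Matrix.transpose_transpose,
      hAq, hqq, show qᵀ * (stdMatrix A)ᵀ = 0 by rw [← Matrix.transpose_mul, hAq,
        Matrix.transpose_zero]]
  rw [hM, sq]
  conv_lhs => rw [← Matrix.det_transpose M, mul_comm]
  rw [Matrix.det_transpose M]
  conv_lhs => enter [2]; rw [← Matrix.det_transpose M]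
  rw [← Matrix.det_mul, hMM, Matrix.det_submatrix_equiv_self, Matrix.det_fromBlocks_zero₂₁,
    Matrix.det_one, mul_one]

theorem abs_det_glue [DecidableEq ι] [DecidableEq κ] (σ : κ ≃ ι ⊕ Fin k)
    {A : EuclideanSpace ℝ κ →L[ℝ] (ι → ℝ)}
    {Q : EuclideanSpace ℝ (Fin k) →ₗᵢ[ℝ] EuclideanSpace ℝ κ}
    (hQ : ∀ w, A (Q w) = 0) :
    |((glue σ).comp (A.prod (ContinuousLinearMap.adjoint Q.toContinuousLinearMap))).det| =
      coareaFactor A := by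
  rw [coareaFactor, ← det_glue_sq σ hQ, Real.sqrt_sq_eq_abs]

end LinearAlgebra

/-! ### Local coarea formula, up to a factor. -/

section Coarea

variable {ι κ : Type*} [Fintype ι] [Fintype κ] [DecidableEq ι] [DecidableEq κ] {k : ℕ}

theorem continuous_stdMatrix {ι κ : Type*} [Fintype ι] [Fintype κ] [DecidableEq κ] :
    Continuous (stdMatrix : (EuclideanSpace ℝ κ →L[ℝ] (ι → ℝ)) → Matrix ι κ ℝ) := by
  refine continuous_matrix fun i j => ?_
  exact (continuous_apply i).comp
    (ContinuousLinearMap.apply ℝ (ι → ℝ) (EuclideanSpace.single j (1 : ℝ))).continuous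

theorem continuous_det_gram : Continuous fun A : EuclideanSpace ℝ κ →L[ℝ] (ι → ℝ) =>
    (stdMatrix A * (stdMatrix A)ᵀ).det :=
  (continuous_stdMatrix.matrix_mul continuous_stdMatrix.matrix_transpose).matrix_det

theorem continuous_coareaFactor :
    Continuous (coareaFactor : (EuclideanSpace ℝ κ →L[ℝ] (ι → ℝ)) → ℝ) :=
  Real.continuous_sqrt.comp continuous_det_gram

/-- Near a regular point, `F` together with a suitable linear projection `P` is a coordinate
system for which the Jacobian determinant and the lengths along the fibers of `F` are
controlled up to a factor `t`. -/
theorem exists_nhds_fiber_control (σ : κ ≃ ι ⊕ Fin k) {F : EuclideanSpace ℝ κ → ι → ℝ}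
    {θ₀ : EuclideanSpace ℝ κ} (hF : ContDiffAt ℝ 1 F θ₀)
    (hdet : 0 < (stdMatrix (fderiv ℝ F θ₀) * (stdMatrix (fderiv ℝ F θ₀))ᵀ).det)
    {t : ℝ} (ht : 1 < t) :
    ∃ P : EuclideanSpace ℝ κ →L[ℝ] EuclideanSpace ℝ (Fin k), ∃ B ∈ 𝓝 θ₀,
      (∀ θ ∈ B,
        coareaFactor (fderiv ℝ F θ) ≤ t * |((glue σ).comp ((fderiv ℝ F θ).prod P)).det| ∧
        |((glue σ).comp ((fderiv ℝ F θ).prod P)).det| ≤ t * coareaFactor (fderiv ℝ F θ)) ∧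
      ∀ x ∈ B, ∀ y ∈ B, F x = F y → ‖P x - P y‖ ≤ ‖x - y‖ ∧ ‖x - y‖ ≤ t * ‖P x - P y‖ := by
  have hk : Fintype.card κ = Fintype.card ι + k := by
    rw [Fintype.card_congr σ, Fintype.card_sum, Fintype.card_fin]
  set A := fderiv ℝ F θ₀ with hA
  obtain ⟨Q, hQ⟩ := exists_isometry_onto_ker (surjective_of_det_ne_zero hdet.ne') hk
  have hAQ : ∀ w, A (Q w) = 0 := by
    intro w
    have : Q w ∈ LinearMap.ker A.toLinearMap := hQ ▸ ⟨w, rfl⟩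
    exact this
  obtain ⟨c, hc, hcA⟩ := exists_norm_le_of_nearly_ker hQ ht
  set P := ContinuousLinearMap.adjoint Q.toContinuousLinearMap with hP
  have hPnorm : ∀ v, ‖P v‖ ≤ ‖v‖ := by
    intro v
    have h1 : ‖P‖ ≤ 1 := by
      rw [hP, LinearIsometryEquiv.norm_map]
      exact Q.norm_toContinuousLinearMap_le
    calc ‖P v‖ ≤ ‖P‖ * ‖v‖ := P.le_opNorm v
      _ ≤ 1 * ‖v‖ := by gcongr
      _ = ‖v‖ := one_mul _
  have hpos : 0 < coareaFactor A := Real.sqrt_pos.2 hdet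
  have hcont : ContinuousAt (fderiv ℝ F) θ₀ :=
    (hF.fderiv_right (m := 0) (by norm_num)).continuousAt
  have hd : ContinuousAt (fun θ => |((glue σ).comp ((fderiv ℝ F θ).prod P)).det|) θ₀ := by
    have h1 : ContinuousAt (fun θ => (glue σ).comp ((fderiv ℝ F θ).prod P)) θ₀ := by
      have h2 : (fun θ => (glue σ).comp ((fderiv ℝ F θ).prod P)) = fun θ =>
          ((glue σ).comp (ContinuousLinearMap.inl ℝ _ _)).comp (fderiv ℝ F θ) +
            ((glue σ).comp (ContinuousLinearMap.inr ℝ _ _)).comp P := by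
        funext θ
        ext1 v
        simp [← map_add]
      rw [h2]
      exact (continuousAt_const.clm_comp hcont).add continuousAt_const
    exact (ContinuousLinearMap.continuous_det.continuousAt.comp h1).abs
  have hj : ContinuousAt (fun θ => coareaFactor (fderiv ℝ F θ)) θ₀ :=
    continuous_coareaFactor.continuousAt.tendsto.comp hcont
  have hdet0 : |((glue σ).comp (A.prod P)).det| = coareaFactor A := abs_det_glue σ hAQ
  -- Both quantities are equal and positive at `θ₀`, so the factor `t > 1` gives strict inequalities
  -- there, which persist nearby by continuity.
  have e1 : ∀ᶠ θ in 𝓝 θ₀, coareaFactor (fderiv ℝ F θ) <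
      t * |((glue σ).comp ((fderiv ℝ F θ).prod P)).det| := by
    refine hj.eventually_lt (hd.const_mul t) ?_
    rw [← hA, hdet0]
    nlinarith
  have e2 : ∀ᶠ θ in 𝓝 θ₀, |((glue σ).comp ((fderiv ℝ F θ).prod P)).det| <
      t * coareaFactor (fderiv ℝ F θ) := by
    refine hd.eventually_lt (hj.const_mul t) ?_
    rw [← hA, hdet0]
    nlinarith
  -- Strict differentiability compares two arbitrary nearby points: if `F x = F y`, then `x - y` is
  -- nearly in the kernel of `A`.
  have e3 := (hF.hasStrictFDerivAt (by norm_num)).isLittleO.bound hc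
  rw [nhds_prod_eq] at e3
  obtain ⟨B₁, hB₁, hB₁'⟩ := eventually_prod_self_iff
    (r := fun x y => ‖F x - F y - fderiv ℝ F θ₀ (x - y)‖ ≤ c * ‖x - y‖).1 e3
  obtain ⟨B₂, hB₂, hB₂'⟩ := (e1.and e2).exists_mem
  refine ⟨P, B₁ ∩ B₂, inter_mem hB₁ hB₂, fun θ hθ => ?_, fun x hx y hy hxy => ?_⟩
  · exact ⟨(hB₂' θ hθ.2).1.le, (hB₂' θ hθ.2).2.le⟩
  · rw [← map_sub]
    refine ⟨hPnorm _, hcA _ ?_⟩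
    have := hB₁' x hx.1 y hy.1
    rwa [hxy, sub_self, zero_sub, norm_neg] at this

theorem euclideanHausdorffMeasure_image_le {X Z : Type*} [EMetricSpace X] [MeasurableSpace X]
    [BorelSpace X] [EMetricSpace Z] [MeasurableSpace Z] [BorelSpace Z] {K : ℝ≥0} {f : X → Z}
    {s : Set X} (h : LipschitzOnWith K f s) (k : ℕ) :
    Measure.euclideanHausdorffMeasure k (f '' s) ≤
      (K : ℝ≥0∞) ^ k * Measure.euclideanHausdorffMeasure k s := by
  simp only [Measure.euclideanHausdorffMeasure_def, Measure.smul_apply, ENNReal.smul_def,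
    smul_eq_mul]
  rw [mul_left_comm]
  gcongr
  simpa using h.hausdorffMeasure_image_le k.cast_nonneg

theorem measurableSet_inter_fiber {α β : Type*} [TopologicalSpace α] [MeasurableSpace α]
    [BorelSpace α] [TopologicalSpace β] [T1Space β] {F : α → β} {s : Set α}
    (hs : MeasurableSet s) (hF : ContinuousOn F s) (z : β) :
    MeasurableSet (s ∩ F ⁻¹' {z}) := by
  obtain ⟨u, hu, hu'⟩ := continuousOn_iff_isClosed.1 hF {z} isClosed_singleton
  rw [inter_comm, hu']
  exact hu.measurableSet.inter hs

/-- The coarea formula up to a factor, on a set where `F` together with a linear projection `P`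
is a controlled coordinate system. -/
theorem exists_fiber_integral_approx (σ : κ ≃ ι ⊕ Fin k) {F : EuclideanSpace ℝ κ → ι → ℝ}
    {s : Set (EuclideanSpace ℝ κ)} (hs : MeasurableSet s)
    (hF : ∀ θ ∈ s, DifferentiableAt ℝ F θ)
    {P : EuclideanSpace ℝ κ →L[ℝ] EuclideanSpace ℝ (Fin k)} {t : ℝ≥0}
    (hP : ∀ θ ∈ s,
        coareaFactor (fderiv ℝ F θ) ≤ t * |((glue σ).comp ((fderiv ℝ F θ).prod P)).det| ∧
        |((glue σ).comp ((fderiv ℝ F θ).prod P)).det| ≤ t * coareaFactor (fderiv ℝ F θ))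
    (hPn : ∀ x ∈ s, ∀ y ∈ s, F x = F y →
      ‖P x - P y‖ ≤ ‖x - y‖ ∧ ‖x - y‖ ≤ t * ‖P x - P y‖)
    {g : EuclideanSpace ℝ κ → ℝ≥0∞} (hg : Measurable g) :
    ∃ h : (ι → ℝ) → ℝ≥0∞, Measurable h ∧
      (∀ z, h z ≤ ∫⁻ θ in s ∩ F ⁻¹' {z}, g θ ∂(Measure.euclideanHausdorffMeasure k)) ∧
      (∀ z, ∫⁻ θ in s ∩ F ⁻¹' {z}, g θ ∂(Measure.euclideanHausdorffMeasure k) ≤ t ^ k * h z) ∧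
      ∫⁻ θ in s, ENNReal.ofReal (coareaFactor (fderiv ℝ F θ)) * g θ ≤ t * ∫⁻ z, h z ∧
      ∫⁻ z, h z ≤ t * ∫⁻ θ in s, ENNReal.ofReal (coareaFactor (fderiv ℝ F θ)) * g θ := by
  set T : EuclideanSpace ℝ κ → EuclideanSpace ℝ κ := fun θ => glue σ (F θ, P θ) with hT
  have hFP : ∀ x ∈ s, ∀ y ∈ s, F x = F y → P x = P y → x = y := by
    intro x hx y hy h1 h2
    have := (hPn x hx y hy h1).2
    rw [h2, sub_self, norm_zero, mul_zero] at this
    exact sub_eq_zero.1 (norm_le_zero_iff.1 this)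
  have hinj : InjOn T s := by
    intro x hx y hy hxy
    have := glue_injective σ hxy
    exact hFP x hx y hy (congrArg Prod.fst this) (congrArg Prod.snd this)
  have hT' : ∀ x ∈ s, HasFDerivWithinAt T ((glue σ).comp ((fderiv ℝ F x).prod P)) s x := by
    intro x hx
    exact ((glue σ).hasFDerivAt.comp x
      ((hF x hx).hasFDerivAt.prodMk P.hasFDerivAt)).hasFDerivWithinAt
  have hFc : ContinuousOn F s := fun x hx => (hF x hx).continuousAt.continuousWithinAt
  have emb := measurableEmbedding_of_fderivWithin hs hT' hinj
  have himg : MeasurableSet (T '' s) := measurable_image_of_fderivWithin hs hT' hinj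
  -- `H` is `g` transported to the chart, `g ∘ T⁻¹` on `T '' s` and `0` elsewhere. The witness `h`
  -- will be its integral over the slice at `z`.
  obtain ⟨H₀, hH₀, hH₀'⟩ := emb.exists_measurable_extend
    (hg.comp measurable_subtype_coe) (fun _ => ⟨0⟩)
  set H := (T '' s).indicator H₀ with hH
  have hHm : Measurable H := hH₀.indicator himg
  have hHT : ∀ θ ∈ s, H (T θ) = g θ := by
    intro θ hθ
    rw [hH, indicator_of_mem (mem_image_of_mem T hθ)]
    exact congrFun hH₀' ⟨θ, hθ⟩
  have hglue : Measurable (glue σ) := (glue σ).continuous.measurable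
  have hHg : Measurable fun p : (ι → ℝ) × EuclideanSpace ℝ (Fin k) => H (glue σ p) :=
    hHm.comp hglue
  have hint : ∫⁻ z, ∫⁻ w, H (glue σ (z, w)) =
      ∫⁻ θ in s, ENNReal.ofReal |((glue σ).comp ((fderiv ℝ F θ).prod P)).det| * g θ := by
    rw [← lintegral_prod _ hHg.aemeasurable, ← Measure.volume_eq_prod,
      (measurePreserving_glue σ).lintegral_comp hHm, hH, lintegral_indicator himg,
      lintegral_image_eq_lintegral_abs_det_fderiv_mul volume hs hT' hinj]
    refine setLIntegral_congr_fun hs fun θ hθ => ?_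
    have := hHT θ hθ
    rw [hH, indicator_of_mem (mem_image_of_mem T hθ)] at this
    simp only [this]
  -- `P` maps the fiber bijectively onto the slice `W`, is 1-Lipschitz on the fiber and has a
  -- `t`-Lipschitz inverse. Hence the image of `ℋ^k` lies between Lebesgue measure on `W` and `t ^
  -- k` times it.
  have key : ∀ z, ∃ W : Set (EuclideanSpace ℝ (Fin k)),
      ∫⁻ w, H (glue σ (z, w)) = ∫⁻ w in W, H (glue σ (z, w)) ∧
      volume.restrict W ≤
        ((Measure.euclideanHausdorffMeasure k).restrict (s ∩ F ⁻¹' {z})).map P ∧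
      ((Measure.euclideanHausdorffMeasure k).restrict (s ∩ F ⁻¹' {z})).map P ≤
        (t : ℝ≥0∞) ^ k • volume.restrict W := by
    intro z
    have hsz := measurableSet_inter_fiber hs hFc z
    have hW : P '' (s ∩ F ⁻¹' {z}) = {w | glue σ (z, w) ∈ T '' s} := by
      ext w
      constructor
      · rintro ⟨θ, ⟨hθ, hz⟩, rfl⟩
        exact ⟨θ, hθ, by simp only [hT]; rw [show F θ = z from hz]⟩
      · rintro ⟨θ, hθ, h⟩
        have := glue_injective σ h
        exact ⟨θ, ⟨hθ, congrArg Prod.fst this⟩, congrArg Prod.snd this⟩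
    have hWm : MeasurableSet (P '' (s ∩ F ⁻¹' {z})) := by
      rw [hW]
      exact (hglue.comp measurable_prodMk_left) himg
    have hPm : Measurable P := P.continuous.measurable
    refine ⟨P '' (s ∩ F ⁻¹' {z}), ?_, ?_, ?_⟩
    · rw [← lintegral_indicator hWm]
      refine lintegral_congr fun w => ?_
      by_cases hw : w ∈ P '' (s ∩ F ⁻¹' {z})
      · rw [indicator_of_mem hw]
      · rw [indicator_of_notMem hw, hH]
        rw [hW] at hw
        exact indicator_of_notMem (f := H₀) (s := T '' s) (a := glue σ (z, w)) hw
    · refine Measure.le_intro fun b hb _ => ?_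
      rw [Measure.map_apply hPm hb, Measure.restrict_apply hb, Measure.restrict_apply (hPm hb),
        ← EuclideanSpace.euclideanHausdorffMeasure_eq_volume, ← image_preimage_inter]
      have hL : LipschitzOnWith 1 P (P ⁻¹' b ∩ (s ∩ F ⁻¹' {z})) := by
        refine LipschitzOnWith.of_dist_le_mul fun x hx y hy => ?_
        rw [dist_eq_norm, dist_eq_norm, NNReal.coe_one, one_mul]
        exact (hPn x hx.2.1 y hy.2.1 (hx.2.2.trans hy.2.2.symm)).1
      simpa using euclideanHausdorffMeasure_image_le hL k
    · refine Measure.le_intro fun b hb _ => ?_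
      rw [Measure.map_apply hPm hb, Measure.smul_apply, Measure.restrict_apply hb,
        Measure.restrict_apply (hPm hb), smul_eq_mul,
        ← EuclideanSpace.euclideanHausdorffMeasure_eq_volume, ← image_preimage_inter]
      set x := P ⁻¹' b ∩ (s ∩ F ⁻¹' {z})
      have hPx : InjOn P x := fun u hu v hv huv =>
        hFP u hu.2.1 v hv.2.1 (hu.2.2.trans hv.2.2.symm) huv
      have hL : LipschitzOnWith t (Function.invFunOn P x) (P '' x) := by
        refine LipschitzOnWith.of_dist_le_mul ?_
        rintro _ ⟨u, hu, rfl⟩ _ ⟨v, hv, rfl⟩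
        rw [hPx.leftInvOn_invFunOn hu, hPx.leftInvOn_invFunOn hv, dist_eq_norm, dist_eq_norm]
        exact (hPn u hu.2.1 v hv.2.1 (hu.2.2.trans hv.2.2.symm)).2
      have := euclideanHausdorffMeasure_image_le hL k
      rwa [hPx.leftInvOn_invFunOn.image_image] at this
  have hφ : ∀ z, ∫⁻ θ in s ∩ F ⁻¹' {z}, g θ ∂(Measure.euclideanHausdorffMeasure k) =
      ∫⁻ w, H (glue σ (z, w))
        ∂(((Measure.euclideanHausdorffMeasure k).restrict (s ∩ F ⁻¹' {z})).map P) := by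
    intro z
    have hm : Measurable fun w => H (glue σ (z, w)) := hHg.comp measurable_prodMk_left
    rw [lintegral_map hm P.continuous.measurable]
    refine setLIntegral_congr_fun (measurableSet_inter_fiber hs hFc z) fun θ hθ => ?_
    simp only [← hHT θ hθ.1, hT]
    rw [show F θ = z from hθ.2]
  refine ⟨fun z => ∫⁻ w, H (glue σ (z, w)), hHg.lintegral_prod_right', fun z => ?_, fun z => ?_,
    ?_, ?_⟩
  · obtain ⟨W, hW, h1, -⟩ := key z
    simp only [hφ, hW]
    exact lintegral_mono' h1 le_rfl
  · obtain ⟨W, hW, -, h2⟩ := key z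
    simp only [hφ, hW]
    rw [← smul_eq_mul, ← lintegral_smul_measure]
    exact lintegral_mono' h2 le_rfl
  · rw [hint, ← lintegral_const_mul' _ _ ENNReal.coe_ne_top]
    refine setLIntegral_mono' hs fun θ hθ => ?_
    rw [← mul_assoc]
    gcongr
    rw [← ENNReal.ofReal_coe_nnreal, ← ENNReal.ofReal_mul t.coe_nonneg]
    exact ENNReal.ofReal_le_ofReal (hP θ hθ).1
  · rw [hint, ← lintegral_const_mul' _ _ ENNReal.coe_ne_top]
    refine setLIntegral_mono' hs fun θ hθ => ?_
    rw [← mul_assoc]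
    gcongr
    rw [← ENNReal.ofReal_coe_nnreal, ← ENNReal.ofReal_mul t.coe_nonneg]
    exact ENNReal.ofReal_le_ofReal (hP θ hθ).2

end Coarea

/-! ### Global coarea formula on the regular set. -/

section Coarea

variable {ι κ : Type*} [Fintype ι] [Fintype κ] [DecidableEq ι] [DecidableEq κ] {k : ℕ}

/-- Countably many of the controlled neighbourhoods cover `s` (Lindelöf). Made disjoint, they give
pieces on which the local estimates hold with the same `t`, and these add up. -/
theorem exists_fiber_integral_approx_of_regular (σ : κ ≃ ι ⊕ Fin k)
    {F : EuclideanSpace ℝ κ → ι → ℝ} {s : Set (EuclideanSpace ℝ κ)} (hs : MeasurableSet s)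
    (hF : ∀ θ ∈ s, ContDiffAt ℝ 1 F θ)
    (hreg : ∀ θ ∈ s, 0 < (stdMatrix (fderiv ℝ F θ) * (stdMatrix (fderiv ℝ F θ))ᵀ).det)
    {t : ℝ≥0} (ht : 1 < t) {g : EuclideanSpace ℝ κ → ℝ≥0∞} (hg : Measurable g) :
    ∃ h : (ι → ℝ) → ℝ≥0∞, Measurable h ∧
      (∀ z, h z ≤ ∫⁻ θ in s ∩ F ⁻¹' {z}, g θ ∂(Measure.euclideanHausdorffMeasure k)) ∧
      (∀ z, ∫⁻ θ in s ∩ F ⁻¹' {z}, g θ ∂(Measure.euclideanHausdorffMeasure k) ≤ t ^ k * h z) ∧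
      ∫⁻ θ in s, ENNReal.ofReal (coareaFactor (fderiv ℝ F θ)) * g θ ≤ t * ∫⁻ z, h z ∧
      ∫⁻ z, h z ≤ t * ∫⁻ θ in s, ENNReal.ofReal (coareaFactor (fderiv ℝ F θ)) * g θ := by
  rcases s.eq_empty_or_nonempty with rfl | ⟨θ₁, hθ₁⟩
  · exact ⟨0, measurable_zero, by simp⟩
  choose! P B hB hdet hfib using fun θ (hθ : θ ∈ s) =>
    exists_nhds_fiber_control σ (hF θ hθ) (hreg θ hθ) (t := t) (by exact_mod_cast ht)
  obtain ⟨c, hcs, hc, hcov⟩ := TopologicalSpace.countable_cover_nhdsWithin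
    (f := fun θ => interior (B θ)) (s := s)
    fun θ hθ => mem_nhdsWithin_of_mem_nhds (interior_mem_nhds.2 (hB θ hθ))
  have hne : c.Nonempty := by
    obtain ⟨θ, hθ, -⟩ := mem_iUnion₂.1 (hcov hθ₁)
    exact ⟨θ, hθ⟩
  obtain ⟨u, rfl⟩ := hc.exists_eq_range hne
  have hus : ∀ n, u n ∈ s := fun n => hcs (mem_range_self n)
  set D : ℕ → Set (EuclideanSpace ℝ κ) :=
    fun n => s ∩ disjointed (fun n => interior (B (u n))) n with hD
  have hDm : ∀ n, MeasurableSet (D n) := fun n =>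
    hs.inter (MeasurableSet.disjointed (fun _ => isOpen_interior.measurableSet) n)
  have hDd : Pairwise (Function.onFun Disjoint D) := fun i j hij =>
    (disjoint_disjointed _ hij).mono inter_subset_right inter_subset_right
  have hDs : ⋃ n, D n = s := by
    rw [hD, ← inter_iUnion, iUnion_disjointed, inter_eq_left]
    simpa using hcov
  have hDB : ∀ n, D n ⊆ B (u n) := fun n =>
    inter_subset_right.trans ((disjointed_subset _ n).trans interior_subset)
  have hDsub : ∀ n, D n ⊆ s := fun n => inter_subset_left
  choose h hm h1 h2 h3 h4 using fun n => exists_fiber_integral_approx σ (hDm n)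
    (fun θ hθ => (hF θ (hDsub n hθ)).differentiableAt one_ne_zero)
    (fun θ hθ => hdet (u n) (hus n) θ (hDB n hθ))
    (fun x hx y hy => hfib (u n) (hus n) x (hDB n hx) y (hDB n hy)) hg
  have hφ : ∀ z, ∫⁻ θ in s ∩ F ⁻¹' {z}, g θ ∂(Measure.euclideanHausdorffMeasure k) =
      ∑' n, ∫⁻ θ in D n ∩ F ⁻¹' {z}, g θ ∂(Measure.euclideanHausdorffMeasure k) := by
    intro z
    conv_lhs => rw [← hDs, iUnion_inter]
    refine lintegral_iUnion (fun n => measurableSet_inter_fiber (hDm n) (fun θ hθ =>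
      (hF θ (hDsub n hθ)).continuousAt.continuousWithinAt) z) (fun i j hij =>
      (hDd hij).mono inter_subset_left inter_subset_left) _
  have hI : ∫⁻ θ in s, ENNReal.ofReal (coareaFactor (fderiv ℝ F θ)) * g θ =
      ∑' n, ∫⁻ θ in D n, ENNReal.ofReal (coareaFactor (fderiv ℝ F θ)) * g θ := by
    conv_lhs => rw [← hDs]
    exact lintegral_iUnion hDm hDd _
  refine ⟨fun z => ∑' n, h n z, Measurable.tsum hm, fun z => ?_, fun z => ?_, ?_, ?_⟩
  · rw [hφ]
    exact ENNReal.tsum_le_tsum fun n => h1 n z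
  · rw [hφ, ← ENNReal.tsum_mul_left]
    exact ENNReal.tsum_le_tsum fun n => h2 n z
  · rw [hI, lintegral_tsum fun n => (hm n).aemeasurable, ← ENNReal.tsum_mul_left]
    exact ENNReal.tsum_le_tsum h3
  · rw [hI, lintegral_tsum fun n => (hm n).aemeasurable, ← ENNReal.tsum_mul_left]
    exact ENNReal.tsum_le_tsum h4

theorem ennreal_le_of_forall_one_lt_le_pow_mul {a b : ℝ≥0∞} (p : ℕ)
    (h : ∀ t : ℝ≥0, 1 < t → a ≤ (t : ℝ≥0∞) ^ p * b) : a ≤ b := by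
  have h1 : Tendsto (fun t : ℝ≥0 => (t : ℝ≥0∞) ^ p * b) (𝓝[>] 1)
      (𝓝 (((1 : ℝ≥0) : ℝ≥0∞) ^ p * b)) := by
    refine Tendsto.mono_left ?_ nhdsWithin_le_nhds
    refine ENNReal.Tendsto.mul_const ?_ (Or.inl (by simp))
    exact ((ENNReal.continuous_pow p).comp ENNReal.continuous_coe).tendsto 1
  rw [ENNReal.coe_one, one_pow, one_mul] at h1
  exact ge_of_tendsto h1 (eventually_mem_nhdsWithin.mono fun t ht => h t ht)

/-- The coarea formula on the set of regular points of a `C¹` map. -/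
theorem coarea (σ : κ ≃ ι ⊕ Fin k)
    {F : EuclideanSpace ℝ κ → ι → ℝ} {s : Set (EuclideanSpace ℝ κ)} (hs : MeasurableSet s)
    (hF : ∀ θ ∈ s, ContDiffAt ℝ 1 F θ)
    (hreg : ∀ θ ∈ s, 0 < (stdMatrix (fderiv ℝ F θ) * (stdMatrix (fderiv ℝ F θ))ᵀ).det)
    {g : EuclideanSpace ℝ κ → ℝ≥0∞} (hg : Measurable g) :
    Measurable (fun z => ∫⁻ θ in s ∩ F ⁻¹' {z}, g θ ∂(Measure.euclideanHausdorffMeasure k)) ∧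
      ∫⁻ z, ∫⁻ θ in s ∩ F ⁻¹' {z}, g θ ∂(Measure.euclideanHausdorffMeasure k) =
        ∫⁻ θ in s, ENNReal.ofReal (coareaFactor (fderiv ℝ F θ)) * g θ := by
  choose! h hm h1 h2 h3 h4 using fun (t : ℝ≥0) (ht : 1 < t) =>
    exists_fiber_integral_approx_of_regular σ hs hF hreg ht hg
  obtain ⟨u, -, hu, hu'⟩ := exists_seq_strictAnti_tendsto (1 : ℝ≥0)
  constructor
  -- Measurability comes from the approximation itself: `h t ≤ fiber integral ≤ t ^ k * h t` for
  -- every `t > 1`, so the fiber integral is the supremum of the `h (u n)` with `u n → 1`.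
  · have : (fun z => ∫⁻ θ in s ∩ F ⁻¹' {z}, g θ ∂(Measure.euclideanHausdorffMeasure k)) =
        fun z => ⨆ n, h (u n) z := by
      funext z
      refine le_antisymm ?_ (iSup_le fun n => h1 _ (hu n) z)
      have hlim : Tendsto (fun n => (u n : ℝ≥0∞) ^ k * ⨆ n, h (u n) z) atTop
          (𝓝 (((1 : ℝ≥0) : ℝ≥0∞) ^ k * ⨆ n, h (u n) z)) := by
        refine ENNReal.Tendsto.mul_const ?_ (Or.inl (by simp))
        exact (((ENNReal.continuous_pow k).comp ENNReal.continuous_coe).tendsto 1).comp hu'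
      rw [ENNReal.coe_one, one_pow, one_mul] at hlim
      refine ge_of_tendsto' hlim fun n => (h2 _ (hu n) z).trans ?_
      gcongr
      exact le_iSup (fun n => h (u n) z) n
    rw [this]
    exact Measurable.iSup fun n => hm _ (hu n)
  -- The exponent `k + 1` collects `t ^ k` from lengths along the fiber and one `t` from the
  -- Jacobian; the converse loses only the latter.
  · refine le_antisymm (ennreal_le_of_forall_one_lt_le_pow_mul (k + 1) fun t ht => ?_)
      (ennreal_le_of_forall_one_lt_le_pow_mul 1 fun t ht => ?_)
    · calc _ ≤ ∫⁻ z, (t : ℝ≥0∞) ^ k * h t z := lintegral_mono (h2 t ht)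
        _ = (t : ℝ≥0∞) ^ k * ∫⁻ z, h t z := lintegral_const_mul _ (hm t ht)
        _ ≤ _ := by
          rw [pow_succ, mul_assoc]
          gcongr
          exact h4 t ht
    · rw [pow_one]
      refine (h3 t ht).trans ?_
      gcongr with z
      exact h1 t ht z

end Coarea

/-! ### Fibers of a map through a null set. -/

section NullFibers

variable {ι κ : Type*} [Fintype ι] [Fintype κ] {k : ℕ}

/-- Almost every fiber of a Lipschitz map meets a null set in a set of vanishing Hausdorff
measure of the complementary dimension. -/
theorem ae_fiber_null_of_lipschitzOnWith (hκ : Fintype.card κ = Fintype.card ι + k) (hk : 0 < k)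
    {F : EuclideanSpace ℝ κ → ι → ℝ} {s : Set (EuclideanSpace ℝ κ)} (hs : volume s = 0)
    {K : ℝ≥0} (hF : LipschitzOnWith K F s) :
    ∀ᵐ z, Measure.euclideanHausdorffMeasure k (s ∩ F ⁻¹' {z}) = 0 := by
  have hH : μH[(Fintype.card κ : ℕ)] s = 0 := by
    rw [← InnerProductSpace.euclideanHausdorffMeasure_eq_volume, finrank_euclideanSpace,
      Measure.euclideanHausdorffMeasure_def, Measure.smul_apply, ENNReal.smul_def, smul_eq_mul,
      mul_eq_zero] at hs
    refine hs.resolve_left fun h => ?_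
    exact Measure.addHaarScalarFactor_volume_hausdorffMeasure_ne_zero _ (ENNReal.coe_eq_zero.1 h)
  set r : ℕ → ℝ≥0∞ := fun j => (j + 1 : ℝ≥0∞)⁻¹ with hr
  have hr0 : ∀ j, 0 < r j := fun j => ENNReal.inv_pos.2 (by finiteness)
  have hrlim : Tendsto r atTop (𝓝 0) := by
    have := (tendsto_add_atTop_iff_nat 1).2 ENNReal.tendsto_inv_nat_nhds_zero
    simpa [hr] using this
  -- As `s` is null for the Hausdorff measure of full dimension, it has arbitrarily fine covers with
  -- arbitrarily small sum of `diam ^ card κ`.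
  have hcov : ∀ j, ∃ T : ℕ → Set (EuclideanSpace ℝ κ), s ⊆ ⋃ i, T i ∧ (∀ i, T i ⊆ s) ∧
      (∀ i, Metric.ediam (T i) ≤ r j) ∧ ∑' i, Metric.ediam (T i) ^ Fintype.card κ ≤ r j := by
    intro j
    rw [Measure.hausdorffMeasure_apply] at hH
    have h1 := (ENNReal.iSup_eq_zero.1 (ENNReal.iSup_eq_zero.1 hH (r j)) (hr0 j)).trans_lt (hr0 j)
    simp only [iInf_lt_iff] at h1
    obtain ⟨T, hT1, hT2, hT3⟩ := h1
    refine ⟨fun i => T i ∩ s, ?_, fun i => inter_subset_right,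
      fun i => (Metric.ediam_mono inter_subset_left).trans (hT2 i), le_trans ?_ hT3.le⟩
    · rw [← iUnion_inter]
      exact subset_inter hT1 subset_rfl
    · refine ENNReal.tsum_le_tsum fun i => ?_
      beta_reduce
      rcases (T i ∩ s).eq_empty_or_nonempty with h | h
      · rw [h, Metric.ediam_empty, zero_pow (by omega)]
        exact zero_le
      · refine le_trans ?_ (le_iSup (fun _ => Metric.ediam (T i) ^ ((Fintype.card κ : ℕ) : ℝ))
          (h.mono inter_subset_left))
        rw [ENNReal.rpow_natCast]
        gcongr
        exact inter_subset_left
  choose T hT1 hTs hT2 hT3 using hcov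
  -- `u j z` bounds the sum of `diam ^ k` over the pieces that meet the fiber at `z`. The images
  -- need not be measurable, so they are replaced by measurable hulls of the same volume.
  set u : ℕ → (ι → ℝ) → ℝ≥0∞ := fun j z =>
    ∑' i, (toMeasurable volume (F '' T j i)).indicator (fun _ => Metric.ediam (T j i) ^ k) z with hu
  have hum : ∀ j, Measurable (u j) := fun j => Measurable.tsum fun i =>
    measurable_const.indicator (measurableSet_toMeasurable _ _)
  have hui : ∀ j, ∫⁻ z, u j z ≤ (K : ℝ≥0∞) ^ Fintype.card ι * r j := by
    intro j
    rw [lintegral_tsum fun i =>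
      (measurable_const.indicator (measurableSet_toMeasurable _ _)).aemeasurable]
    refine le_trans ?_ (mul_le_mul_right (hT3 j) _)
    rw [← ENNReal.tsum_mul_left]
    refine ENNReal.tsum_le_tsum fun i => ?_
    rw [lintegral_indicator_const (measurableSet_toMeasurable _ _), measure_toMeasurable]
    -- The image of a piece has volume at most `(K diam) ^ card ι`; with the weight `diam ^ k` this
    -- gives the full power `diam ^ card κ`, whose sum is small.
    have h1 : volume (F '' T j i) ≤ (K * Metric.ediam (T j i)) ^ Fintype.card ι := by
      refine (Real.volume_pi_le_diam_pow _).trans ?_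
      gcongr
      refine Metric.ediam_image_le_iff.2 fun x hx y hy => (hF (hTs j i hx) (hTs j i hy)).trans ?_
      gcongr
      exact Metric.edist_le_ediam_of_mem hx hy
    calc _ ≤ Metric.ediam (T j i) ^ k * (K * Metric.ediam (T j i)) ^ Fintype.card ι := by gcongr
      _ = _ := by rw [hκ, mul_pow, pow_add]; ring
  -- Fatou's lemma: the integrals of `u j` tend to `0`, so `liminf u j` vanishes almost everywhere.
  -- It dominates the Hausdorff measure of the fiber.
  have hlim : ∫⁻ z, liminf (fun j => u j z) atTop = 0 := by
    refine le_antisymm ((lintegral_liminf_le hum).trans ?_) zero_le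
    have h1 : Tendsto (fun j => (K : ℝ≥0∞) ^ Fintype.card ι * r j) atTop (𝓝 0) := by
      have := ENNReal.Tendsto.const_mul (a := (K : ℝ≥0∞) ^ Fintype.card ι) hrlim
        (Or.inr (by finiteness))
      rwa [mul_zero] at this
    rw [← h1.liminf_eq]
    exact liminf_le_liminf (Eventually.of_forall hui)
  rw [lintegral_eq_zero_iff (Measurable.liminf hum)] at hlim
  filter_upwards [hlim] with z hz
  rw [Measure.euclideanHausdorffMeasure_def, Measure.smul_apply, ENNReal.smul_def, smul_eq_mul]
  refine mul_eq_zero_of_right _ (le_antisymm ?_ zero_le)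
  refine (Measure.hausdorffMeasure_le_liminf_tsum (l := atTop) (k : ℝ) _ r hrlim
    (fun j i => T j i ∩ F ⁻¹' {z}) (Eventually.of_forall fun j i =>
      (Metric.ediam_mono inter_subset_left).trans (hT2 j i))
    (Eventually.of_forall fun j => ?_)).trans ?_
  · rw [← iUnion_inter]
    exact inter_subset_inter_left _ (hT1 j)
  · refine le_trans (liminf_le_liminf (Eventually.of_forall fun j => ?_)) hz.le
    refine ENNReal.tsum_le_tsum fun i => ?_
    rw [ENNReal.rpow_natCast]
    rcases (T j i ∩ F ⁻¹' {z}).eq_empty_or_nonempty with h | ⟨θ, hθ, hθz⟩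
    -- An empty piece must contribute `0`, and `0 ^ k = 0` requires `k > 0`.
    · rw [h, Metric.ediam_empty, zero_pow hk.ne']
      exact zero_le
    · rw [indicator_of_mem (subset_toMeasurable volume (F '' T j i) ⟨θ, hθ, hθz⟩)]
      gcongr
      exact inter_subset_left

/-- A `C¹` map is locally Lipschitz, and countably many of the Lipschitz neighbourhoods cover `s`.
-/
theorem ae_fiber_null (hκ : Fintype.card κ = Fintype.card ι + k) (hk : 0 < k)
    {F : EuclideanSpace ℝ κ → ι → ℝ} {s : Set (EuclideanSpace ℝ κ)} (hs : volume s = 0)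
    (hF : ∀ θ ∈ s, ContDiffAt ℝ 1 F θ) :
    ∀ᵐ z, Measure.euclideanHausdorffMeasure k (s ∩ F ⁻¹' {z}) = 0 := by
  choose! K B hB hL using fun θ (hθ : θ ∈ s) => (hF θ hθ).exists_lipschitzOnWith
  obtain ⟨c, hcs, hc, hcov⟩ := TopologicalSpace.countable_cover_nhdsWithin
    (f := B) (s := s) fun θ hθ => mem_nhdsWithin_of_mem_nhds (hB θ hθ)
  have h : ∀ᵐ z, ∀ θ ∈ c, Measure.euclideanHausdorffMeasure k ((s ∩ B θ) ∩ F ⁻¹' {z}) = 0 := by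
    refine (ae_ball_iff hc).2 fun θ hθ => ?_
    exact ae_fiber_null_of_lipschitzOnWith hκ hk (measure_mono_null inter_subset_left hs)
      ((hL θ (hcs hθ)).mono inter_subset_right)
  filter_upwards [h] with z hz
  refine measure_mono_null ?_ ((measure_biUnion_null_iff hc).2 hz)
  rintro θ ⟨hθ, hθz⟩
  obtain ⟨a, ha, haB⟩ := mem_iUnion₂.1 (hcov hθ)
  exact mem_iUnion₂.2 ⟨a, ha, ⟨hθ, haB⟩, hθz⟩

end NullFibers

/-! ### The image of the prior under `F` in the data space. -/

section DataSpace

variable {m n d : ℕ}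

/-- The identification of `ℝ^{n × m}`, as a space of rows, with a space of coordinates. -/
def flatten : (Fin n → EuclideanSpace ℝ (Fin m)) ≃L[ℝ] (Fin n × Fin m → ℝ) :=
  LinearEquiv.toContinuousLinearEquiv
    { toFun := fun z p => z p.1 p.2
      map_add' := fun _ _ => rfl
      map_smul' := fun _ _ => rfl
      invFun := fun w i => WithLp.toLp 2 fun j => w (i, j)
      left_inv := fun _ => rfl
      right_inv := fun _ => rfl }

theorem measurePreserving_flatten :
    MeasurePreserving (flatten : (Fin n → EuclideanSpace ℝ (Fin m)) ≃L[ℝ] _) := by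
  have hm : Measurable (flatten : (Fin n → EuclideanSpace ℝ (Fin m)) ≃L[ℝ] _) :=
    flatten.continuous.measurable
  refine ⟨hm, (Measure.pi_eq fun s hs => ?_).symm⟩
  rw [Measure.map_apply hm (MeasurableSet.univ_pi hs)]
  have h1 : (flatten : (Fin n → EuclideanSpace ℝ (Fin m)) ≃L[ℝ] _) ⁻¹' univ.pi s =
      univ.pi fun i => WithLp.ofLp ⁻¹' univ.pi fun j => s (i, j) := by
    ext z
    simp only [mem_preimage, mem_univ_pi]
    exact Prod.forall
  rw [h1, volume_pi_pi, Fintype.prod_prod_type]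
  refine Finset.prod_congr rfl fun i _ => ?_
  rw [(PiLp.volume_preserving_ofLp (Fin m)).measure_preimage
    (MeasurableSet.univ_pi fun j => hs (i, j)).nullMeasurableSet, volume_pi_pi]

theorem stdMatrix_fderiv_flatten
    (F : EuclideanSpace ℝ (Fin d) → Fin n → EuclideanSpace ℝ (Fin m))
    (θ : EuclideanSpace ℝ (Fin d)) :
    stdMatrix (fderiv ℝ (flatten ∘ F) θ) = jacobianMatrix F θ := by
  rw [ContinuousLinearEquiv.comp_fderiv]
  rfl

theorem measurable_det_gramMatrix
    (F : EuclideanSpace ℝ (Fin d) → Fin n → EuclideanSpace ℝ (Fin m)) :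
    Measurable fun θ => (gramMatrix F θ).det := by
  have h := (continuous_det_gram (ι := Fin n × Fin m) (κ := Fin d)).measurable.comp
    (measurable_fderiv ℝ (flatten ∘ F))
  convert h using 2 with θ
  rw [Function.comp_apply, stdMatrix_fderiv_flatten, gramMatrix]

theorem fiber_flatten (F : EuclideanSpace ℝ (Fin d) → Fin n → EuclideanSpace ℝ (Fin m))
    (z : Fin n → EuclideanSpace ℝ (Fin m)) : (flatten ∘ F) ⁻¹' {flatten z} = F ⁻¹' {z} := by
  ext θ
  simp

theorem coarea_gramMatrix (hd : m * n ≤ d)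
    {F : EuclideanSpace ℝ (Fin d) → Fin n → EuclideanSpace ℝ (Fin m)}
    {s : Set (EuclideanSpace ℝ (Fin d))} (hs : MeasurableSet s)
    (hF : ∀ θ ∈ s, ContDiffAt ℝ 1 F θ) (hreg : ∀ θ ∈ s, 0 < (gramMatrix F θ).det)
    {g : EuclideanSpace ℝ (Fin d) → ℝ≥0∞} (hg : Measurable g) :
    Measurable (fun z =>
        ∫⁻ θ in s ∩ F ⁻¹' {z}, g θ ∂(Measure.euclideanHausdorffMeasure (d - m * n))) ∧
      ∫⁻ z, ∫⁻ θ in s ∩ F ⁻¹' {z}, g θ ∂(Measure.euclideanHausdorffMeasure (d - m * n)) =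
        ∫⁻ θ in s, ENNReal.ofReal √(gramMatrix F θ).det * g θ := by
  have hcard : Fintype.card (Fin d) = Fintype.card ((Fin n × Fin m) ⊕ Fin (d - m * n)) := by
    simp only [Fintype.card_sum, Fintype.card_prod, Fintype.card_fin]
    rw [mul_comm n m]
    omega
  obtain ⟨h1, h2⟩ := coarea (Fintype.equivOfCardEq hcard) (F := flatten ∘ F) hs
    (fun θ hθ => flatten.contDiff.contDiffAt.comp θ (hF θ hθ))
    (fun θ hθ => by rw [stdMatrix_fderiv_flatten]; exact hreg θ hθ) hg
  constructor
  · have := h1.comp (measurePreserving_flatten (n := n) (m := m)).measurable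
    convert this using 2 with z
    rw [Function.comp_apply, fiber_flatten]
  · rw [← (measurePreserving_flatten (n := n) (m := m)).lintegral_comp h1] at h2
    simp only [fiber_flatten, coareaFactor, stdMatrix_fderiv_flatten] at h2
    exact h2

theorem ae_fiber_null_dataSpace (hd : m * n < d)
    {F : EuclideanSpace ℝ (Fin d) → Fin n → EuclideanSpace ℝ (Fin m)}
    {s : Set (EuclideanSpace ℝ (Fin d))} (hs : volume s = 0)
    (hF : ∀ θ ∈ s, ContDiffAt ℝ 1 F θ) :
    ∀ᵐ z, Measure.euclideanHausdorffMeasure (d - m * n) (s ∩ F ⁻¹' {z}) = 0 := by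
  have hcard : Fintype.card (Fin d) = Fintype.card (Fin n × Fin m) + (d - m * n) := by
    simp only [Fintype.card_prod, Fintype.card_fin]
    rw [mul_comm n m]
    omega
  have h := ae_fiber_null hcard (by omega) (F := flatten ∘ F) hs
    (fun θ hθ => flatten.contDiff.contDiffAt.comp θ (hF θ hθ))
  have := (measurePreserving_flatten (n := n) (m := m)).quasiMeasurePreserving.ae h
  simpa only [fiber_flatten] using this

theorem measurable_weightedPrior
    (F : EuclideanSpace ℝ (Fin d) → Fin n → EuclideanSpace ℝ (Fin m))
    {π : EuclideanSpace ℝ (Fin d) → ℝ} (hπ : Measurable π) : Measurable (weightedPrior F π) :=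
  hπ.ennreal_ofReal.div ((measurable_det_gramMatrix F).ennreal_ofReal.pow_const _)

theorem sqrt_det_mul_weightedPrior
    {F : EuclideanSpace ℝ (Fin d) → Fin n → EuclideanSpace ℝ (Fin m)}
    (π : EuclideanSpace ℝ (Fin d) → ℝ) {θ : EuclideanSpace ℝ (Fin d)}
    (hθ : 0 < (gramMatrix F θ).det) :
    ENNReal.ofReal √(gramMatrix F θ).det * weightedPrior F π θ = ENNReal.ofReal (π θ) := by
  rw [weightedPrior, ENNReal.ofReal_rpow_of_pos hθ, ← Real.sqrt_eq_rpow]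
  exact ENNReal.mul_div_cancel (ENNReal.ofReal_pos.2 (Real.sqrt_pos.2 hθ)).ne'
    ENNReal.ofReal_ne_top

/-- The dual prior is almost everywhere measurable, and it is the density of the image of the
prior under `F`. -/
theorem dualPrior_spec (hd : m * n < d) {Θ : Set (EuclideanSpace ℝ (Fin d))}
    (hΘ : MeasurableSet Θ) {F : EuclideanSpace ℝ (Fin d) → Fin n → EuclideanSpace ℝ (Fin m)}
    (hF : ∀ θ ∈ Θ, ContDiffAt ℝ 1 F θ) {π : EuclideanSpace ℝ (Fin d) → ℝ} (hπ : Measurable π)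
    (h_int : ∫⁻ θ in Θ, weightedPrior F π θ < ⊤) :
    AEMeasurable (dualPrior Θ F π) volume ∧
      ∀ ψ : (Fin n → EuclideanSpace ℝ (Fin m)) → ℝ≥0∞, Measurable ψ →
        ∫⁻ z, ψ z * dualPrior Θ F π z = ∫⁻ θ in Θ, ψ (F θ) * ENNReal.ofReal (π θ) := by
  set w := weightedPrior F π with hw
  have hwm : Measurable w := measurable_weightedPrior F hπ
  have hpos : MeasurableSet {θ | 0 < (gramMatrix F θ).det} :=
    measurableSet_lt measurable_const (measurable_det_gramMatrix F)
  set R := Θ ∩ {θ | 0 < (gramMatrix F θ).det} with hR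
  set C := Θ \ {θ | 0 < (gramMatrix F θ).det} with hC
  have hRm : MeasurableSet R := hΘ.inter hpos
  have hCm : MeasurableSet C := hΘ.diff hpos
  have hRC : Disjoint R C := disjoint_left.2 fun θ h1 h2 => h2.2 h1.2
  have hRCu : R ∪ C = Θ := inter_union_sdiff _ _
  have hFc : ContinuousOn F Θ := fun θ hθ => (hF θ hθ).continuousAt.continuousWithinAt
  have hwC : ∀ θ ∈ C, w θ = ENNReal.ofReal (π θ) / 0 := by
    intro θ hθ
    have h : ENNReal.ofReal (gramMatrix F θ).det = 0 := ENNReal.ofReal_eq_zero.2 (not_lt.1 hθ.2)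
    rw [hw, weightedPrior, h, ENNReal.zero_rpow_of_pos (by norm_num)]
  -- At a critical point with `π > 0` the weight is `∞`, which a finite integral allows only on a
  -- null set.
  have hN : volume (C ∩ {θ | 0 < π θ}) = 0 := by
    have h1 := (ae_restrict_iff' hΘ).1 (ae_lt_top hwm h_int.ne)
    refine measure_mono_null (fun θ hθ => ?_) h1
    intro h2
    have h3 := h2 hθ.1.1
    rw [hwC θ hθ.1, ENNReal.div_zero (ENNReal.ofReal_pos.2 hθ.2).ne'] at h3
    exact lt_irrefl _ h3
  set φ : (Fin n → EuclideanSpace ℝ (Fin m)) → ℝ≥0∞ := fun z =>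
    ∫⁻ θ in R ∩ F ⁻¹' {z}, w θ ∂(Measure.euclideanHausdorffMeasure (d - m * n)) with hφ
  have hFR : ∀ θ ∈ R, ContDiffAt ℝ 1 F θ := fun θ hθ => hF θ hθ.1
  have hreg : ∀ θ ∈ R, 0 < (gramMatrix F θ).det := fun θ hθ => hθ.2
  have hφm : Measurable φ := (coarea_gramMatrix hd.le hRm hFR hreg hwm).1
  -- Critical points contribute nothing to almost every fiber: where `π ≤ 0` the weight is `0 / 0 =
  -- 0`, and the others form the null set of `hN`.
  have hae : dualPrior Θ F π =ᵐ[volume] φ := by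
    filter_upwards [ae_fiber_null_dataSpace hd hN fun θ hθ => hF θ hθ.1.1] with z hz
    have hCz := measurableSet_inter_fiber hCm (hFc.mono sdiff_subset) z
    have h1 : {θ | θ ∈ Θ ∧ F θ = z} = (R ∩ F ⁻¹' {z}) ∪ (C ∩ F ⁻¹' {z}) := by
      rw [← union_inter_distrib_right, hRCu]
      rfl
    rw [dualPrior, h1, lintegral_union hCz (hRC.mono inter_subset_left inter_subset_left)]
    have h2 : ∫⁻ θ in C ∩ F ⁻¹' {z}, w θ ∂(Measure.euclideanHausdorffMeasure (d - m * n)) = 0 := by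
      rw [lintegral_eq_zero_iff hwm]
      refine (ae_restrict_iff' hCz).2 (measure_mono_null (fun θ hθ => ?_) hz)
      simp only [mem_compl_iff, mem_ofPred_eq, Classical.not_imp] at hθ
      refine ⟨⟨hθ.1.1, ?_⟩, hθ.1.2⟩
      by_contra h
      refine hθ.2 ?_
      rw [hwC θ hθ.1.1, ENNReal.ofReal_eq_zero.2 (not_lt.1 h), ENNReal.zero_div]
      rfl
    rw [h2, add_zero]
  refine ⟨⟨φ, hφm, hae⟩, fun ψ hψ => ?_⟩
  classical
  -- `F` is controlled only on `Θ`, whereas the coarea formula takes a globally measurable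
  -- integrand; `F'` is measurable and agrees with `F` on `R`.
  set F' := R.piecewise F 0 with hF'
  have hF'm : Measurable F' :=
    (hFc.mono inter_subset_left).measurable_piecewise continuousOn_const hRm
  have hF'R : ∀ θ ∈ R, F' θ = F θ := fun θ hθ => piecewise_eq_of_mem _ _ _ hθ
  have hC0 : ∫⁻ θ in C, ψ (F θ) * ENNReal.ofReal (π θ) = 0 := by
    have : ∫⁻ θ in C, ψ (F θ) * ENNReal.ofReal (π θ) = ∫⁻ θ in C, 0 := by
      refine lintegral_congr_ae ((ae_restrict_iff' hCm).2 (measure_mono_null (fun θ hθ => ?_) hN))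
      simp only [mem_compl_iff, mem_ofPred_eq, Classical.not_imp] at hθ
      refine ⟨hθ.1, ?_⟩
      by_contra h
      exact hθ.2 (by rw [ENNReal.ofReal_eq_zero.2 (not_lt.1 h), mul_zero])
    rw [this, lintegral_zero]
  calc ∫⁻ z, ψ z * dualPrior Θ F π z
      = ∫⁻ z, ψ z * φ z := lintegral_congr_ae (hae.mono fun z hz => by simp only [hz])
    _ = ∫⁻ z, ∫⁻ θ in R ∩ F ⁻¹' {z}, ψ (F' θ) * w θ
          ∂(Measure.euclideanHausdorffMeasure (d - m * n)) := by
        refine lintegral_congr fun z => ?_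
        rw [← lintegral_const_mul _ hwm]
        refine setLIntegral_congr_fun (measurableSet_inter_fiber hRm
          (hFc.mono inter_subset_left) z) fun θ hθ => ?_
        simp only [hF'R θ hθ.1]
        rw [show F θ = z from hθ.2]
    _ = ∫⁻ θ in R, ENNReal.ofReal √(gramMatrix F θ).det * (ψ (F' θ) * w θ) :=
        (coarea_gramMatrix hd.le hRm hFR hreg ((hψ.comp hF'm).mul hwm)).2
    _ = ∫⁻ θ in R, ψ (F θ) * ENNReal.ofReal (π θ) := by
        refine setLIntegral_congr_fun hRm fun θ hθ => ?_
        simp only [hF'R θ hθ]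
        rw [mul_left_comm, sqrt_det_mul_weightedPrior π (hreg θ hθ)]
    _ = ∫⁻ θ in Θ, ψ (F θ) * ENNReal.ofReal (π θ) := by
        rw [← hRCu, lintegral_union hCm hRC, hC0, add_zero]

end DataSpace

/-! ### Gibbs likelihoods: product form, normalization, measurability. -/

section Gibbs

variable {m n : ℕ}

theorem lintegral_pi_prod_mul {α : Type*} [MeasurableSpace α] (μ : Measure α) [SigmaFinite μ]
    {n : ℕ} {g : Fin n → α → ℝ≥0∞} (hg : ∀ i, Measurable (g i)) :
    ∫⁻ y, ∏ i, g i (y i) ∂(Measure.pi fun _ : Fin n => μ) = ∏ i, ∫⁻ v, g i v ∂μ := by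
  induction n with
  | zero => simp
  | succ n ih =>
    have h := (measurePreserving_piFinSuccAbove (fun _ : Fin (n + 1) => μ) 0).symm
    rw [← h.lintegral_comp (by fun_prop)]
    simp only [Fin.prod_univ_succ, MeasurableEquiv.piFinSuccAbove_symm_apply,
      Fin.insertNthEquiv_apply, Fin.insertNth_zero', Fin.cons_zero, Fin.cons_succ]
    have hm : Measurable fun y : Fin n → α => ∏ i, g i.succ (y i) :=
      Finset.measurable_prod _ fun i _ => (hg i.succ).comp (measurable_pi_apply i)
    rw [lintegral_prod_mul (hg 0).aemeasurable hm.aemeasurable, ih fun i => hg i.succ]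

/-- The Gibbs weight `exp(-ℓ(u, v) / γ)`, cut off outside `𝒴 × 𝒴`. -/
def gibbsWeight (Y : Set (EuclideanSpace ℝ (Fin m)))
    (ℓ : EuclideanSpace ℝ (Fin m) → EuclideanSpace ℝ (Fin m) → ℝ) (γ : ℝ) :
    EuclideanSpace ℝ (Fin m) × EuclideanSpace ℝ (Fin m) → ℝ≥0∞ :=
  (Y ×ˢ Y).indicator fun p => ENNReal.ofReal (Real.exp (-(1 / γ) * ℓ p.1 p.2))

variable {Y : Set (EuclideanSpace ℝ (Fin m))}
  {ℓ : EuclideanSpace ℝ (Fin m) → EuclideanSpace ℝ (Fin m) → ℝ} {γ : ℝ}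

theorem gibbsWeight_of_mem {u v : EuclideanSpace ℝ (Fin m)} (hu : u ∈ Y) (hv : v ∈ Y) :
    gibbsWeight Y ℓ γ (u, v) = ENNReal.ofReal (Real.exp (-(1 / γ) * ℓ u v)) :=
  indicator_of_mem (mk_mem_prod hu hv) _

theorem measurable_gibbsWeight (hY : MeasurableSet Y)
    (hℓ : ContinuousOn (fun p : EuclideanSpace ℝ (Fin m) × EuclideanSpace ℝ (Fin m) =>
      ℓ p.1 p.2) (Y ×ˢ Y)) : Measurable (gibbsWeight Y ℓ γ) := by
  classical
  rw [gibbsWeight, ← piecewise_eq_indicator]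
  refine ContinuousOn.measurable_piecewise ?_ continuousOn_const (hY.prod hY)
  exact ENNReal.continuous_ofReal.comp_continuousOn
    (Real.continuous_exp.comp_continuousOn (continuousOn_const.mul hℓ))

theorem lintegral_gibbsWeight (hY : MeasurableSet Y) {u : EuclideanSpace ℝ (Fin m)}
    (hu : u ∈ Y) : ∫⁻ v in Y, gibbsWeight Y ℓ γ (u, v) = gibbsIntegral Y ℓ γ u :=
  setLIntegral_congr_fun hY fun _ hv => gibbsWeight_of_mem hu hv

theorem dualLikelihood_eq {y z : Fin n → EuclideanSpace ℝ (Fin m)} (hy : ∀ i, y i ∈ Y)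
    (hz : ∀ i, z i ∈ Y) :
    dualLikelihood Y ℓ γ y z =
      (∏ i, gibbsIntegral Y ℓ γ (z i))⁻¹ * ∏ i, gibbsWeight Y ℓ γ (z i, y i) := by
  simp only [gibbsWeight_of_mem (hz _) (hy _)]
  rw [dualLikelihood, normConst, totalLoss, Finset.mul_sum, Real.exp_sum,
    ENNReal.ofReal_prod_of_nonneg fun _ _ => (Real.exp_pos _).le]

theorem prod_gibbsLikelihood_eq_dualLikelihood
    (h_gibbs : ∀ u ∈ Y, gibbsIntegral Y ℓ γ u < ⊤)
    {y z : Fin n → EuclideanSpace ℝ (Fin m)} (hy : ∀ i, y i ∈ Y) (hz : ∀ i, z i ∈ Y) :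
    ∏ i, gibbsLikelihood Y ℓ γ (z i) (y i) = dualLikelihood Y ℓ γ y z := by
  -- In `[0, ∞]` the inverse of the product splits because no factor is `∞`, which excludes the
  -- product `0 * ∞`.
  rw [dualLikelihood_eq hy hz,
    ENNReal.prod_inv_distrib fun i _ j _ _ => Or.inr (h_gibbs _ (hz j)).ne,
    ← Finset.prod_mul_distrib]
  refine Finset.prod_congr rfl fun i _ => ?_
  rw [gibbsWeight_of_mem (hz i) (hy i), gibbsLikelihood, div_eq_mul_inv, mul_comm]

theorem gibbsIntegral_ne_zero (hY : MeasurableSet Y)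
    (hℓ : ContinuousOn (fun p : EuclideanSpace ℝ (Fin m) × EuclideanSpace ℝ (Fin m) =>
      ℓ p.1 p.2) (Y ×ˢ Y)) (hvol : volume Y ≠ 0) {u : EuclideanSpace ℝ (Fin m)} (hu : u ∈ Y) :
    gibbsIntegral Y ℓ γ u ≠ 0 := by
  have hm : Measurable fun v => gibbsWeight Y ℓ γ (u, v) :=
    (measurable_gibbsWeight hY hℓ).comp measurable_prodMk_left
  rw [← lintegral_gibbsWeight hY hu, Ne, lintegral_eq_zero_iff hm]
  intro h
  refine hvol (measure_mono_null (fun v hv => ?_) ((ae_restrict_iff' hY).1 h))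
  intro h'
  have : gibbsWeight Y ℓ γ (u, v) = 0 := h' hv
  rw [gibbsWeight_of_mem hu hv] at this
  exact (ENNReal.ofReal_pos.2 (Real.exp_pos _)).ne' this

theorem isProbDensity_dualLikelihood (hY : MeasurableSet Y)
    (hℓ : ContinuousOn (fun p : EuclideanSpace ℝ (Fin m) × EuclideanSpace ℝ (Fin m) =>
      ℓ p.1 p.2) (Y ×ˢ Y))
    (h_gibbs : ∀ u ∈ Y, gibbsIntegral Y ℓ γ u < ⊤)
    (hvol : volume (univ.pi fun _ : Fin n => Y) ≠ 0)
    {z : Fin n → EuclideanSpace ℝ (Fin m)} (hz : ∀ i, z i ∈ Y) :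
    IsProbDensity (volume.restrict (univ.pi fun _ : Fin n => Y))
      (fun y => dualLikelihood Y ℓ γ y z) := by
  have hYn : MeasurableSet (univ.pi fun _ : Fin n => Y) := MeasurableSet.univ_pi fun _ => hY
  have hw : ∀ i, Measurable fun v => gibbsWeight Y ℓ γ (z i, v) := fun i =>
    (measurable_gibbsWeight hY hℓ).comp measurable_prodMk_left
  have hm : Measurable fun y : Fin n → EuclideanSpace ℝ (Fin m) =>
      ∏ i, gibbsWeight Y ℓ γ (z i, y i) :=
    Finset.measurable_prod _ fun i _ => (hw i).comp (measurable_pi_apply i)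
  have heq : EqOn (fun y => dualLikelihood Y ℓ γ y z) (fun y =>
      (∏ i, gibbsIntegral Y ℓ γ (z i))⁻¹ * ∏ i, gibbsWeight Y ℓ γ (z i, y i))
      (univ.pi fun _ : Fin n => Y) := fun y hy => dualLikelihood_eq (fun i => hy i trivial) hz
  refine ⟨⟨_, hm.const_mul _, (ae_restrict_iff' hYn).2 (Eventually.of_forall heq)⟩, ?_⟩
  rw [setLIntegral_congr_fun hYn heq, lintegral_const_mul _ hm, volume_pi,
    Measure.restrict_pi_pi, lintegral_pi_prod_mul _ hw]
  simp only [lintegral_gibbsWeight hY (hz _)]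
  refine ENNReal.inv_mul_cancel (Finset.prod_ne_zero_iff.2 fun i _ => ?_)
    (ENNReal.prod_ne_top fun i _ => (h_gibbs _ (hz i)).ne)
  refine gibbsIntegral_ne_zero hY hℓ (fun h => hvol ?_) (hz i)
  rw [volume_pi_pi]
  exact Finset.prod_eq_zero (Finset.mem_univ i) h

/-- The loss is continuous only on `𝒴 × 𝒴`, so the cut-off is what makes the dual likelihood an
admissible test function in `dualPrior_spec`. Measurability of the normalizers in `z` is Tonelli's
theorem. -/
theorem measurable_indicator_dualLikelihood (hY : MeasurableSet Y)
    (hℓ : ContinuousOn (fun p : EuclideanSpace ℝ (Fin m) × EuclideanSpace ℝ (Fin m) =>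
      ℓ p.1 p.2) (Y ×ˢ Y)) {y : Fin n → EuclideanSpace ℝ (Fin m)} (hy : ∀ i, y i ∈ Y) :
    Measurable ((univ.pi fun _ : Fin n => Y).indicator (dualLikelihood Y ℓ γ y)) := by
  have hw := measurable_gibbsWeight (γ := γ) hY hℓ
  have hG : Measurable fun u => ∫⁻ v in Y, gibbsWeight Y ℓ γ (u, v) := hw.lintegral_prod_right'
  have heq : (univ.pi fun _ : Fin n => Y).indicator (dualLikelihood Y ℓ γ y) =
      (univ.pi fun _ : Fin n => Y).indicator fun z =>
        (∏ i, ∫⁻ v in Y, gibbsWeight Y ℓ γ (z i, v))⁻¹ * ∏ i, gibbsWeight Y ℓ γ (z i, y i) := by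
    refine indicator_congr fun z hz => ?_
    rw [dualLikelihood_eq hy fun i => hz i trivial]
    simp only [lintegral_gibbsWeight hY (hz _ trivial)]
  rw [heq]
  refine Measurable.indicator ?_ (MeasurableSet.univ_pi fun _ => hY)
  refine (Finset.measurable_prod _ fun i _ => hG.comp (measurable_pi_apply i)).inv.mul ?_
  exact Finset.measurable_prod _ fun i _ =>
    hw.comp ((measurable_pi_apply i).prodMk measurable_const)

end Gibbs

theorem SmoothNear.contDiffAt {E G : Type*} [NormedAddCommGroup E] [NormedSpace ℝ E]
    [NormedAddCommGroup G] [NormedSpace ℝ G] {h : E → G} {S : Set E} (hh : SmoothNear h S)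
    {θ : E} (hθ : θ ∈ S) : ContDiffAt ℝ 1 h θ := by
  obtain ⟨U, hU, hSU, hUs⟩ := hh
  exact (hUs.contDiffAt (hU.mem_nhds (hSU hθ))).of_le (by exact_mod_cast le_top)

end BayesianDuality

end

/-! ### The duality theorem. -/

theorem mainTheorem2 {X : Type*} {d m n : ℕ} (hd : m * n < d)
    (Θ : Set (EuclideanSpace ℝ (Fin d))) (hΘ : MeasurableSet Θ)
    (Y : Set (EuclideanSpace ℝ (Fin m))) (hY : MeasurableSet Y)
    (f : X → EuclideanSpace ℝ (Fin d) → EuclideanSpace ℝ (Fin m))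
    (hf_maps : ∀ a, ∀ θ ∈ Θ, f a θ ∈ Y)
    (hf_smooth : ∀ a, BayesianDuality.SmoothNear (f a) Θ)
    (ℓ : EuclideanSpace ℝ (Fin m) → EuclideanSpace ℝ (Fin m) → ℝ)
    (hℓ_nonneg : ∀ u ∈ Y, ∀ v ∈ Y, 0 ≤ ℓ u v)
    (hℓ_cont : ContinuousOn (fun p : EuclideanSpace ℝ (Fin m) × EuclideanSpace ℝ (Fin m) =>
      ℓ p.1 p.2) (Y ×ˢ Y))
    (γ : ℝ) (hγ : 0 < γ)
    (h_gibbs : ∀ u ∈ Y, BayesianDuality.gibbsIntegral Y ℓ γ u < ⊤)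
    (π : EuclideanSpace ℝ (Fin d) → ℝ) (hπ_meas : Measurable π)
    (hπ_nonneg : ∀ θ ∈ Θ, 0 ≤ π θ)
    (hπ_one : ∫⁻ θ in Θ, ENNReal.ofReal (π θ) = 1)
    (x : Fin n → X)
    (h_int : ∫⁻ θ in Θ,
      BayesianDuality.weightedPrior (BayesianDuality.dataMap f x) π θ < ⊤) :
    BayesianDuality.IsProbDensity volume
        (BayesianDuality.dualPrior Θ (BayesianDuality.dataMap f x) π) ∧
      (∀ z : Fin n → EuclideanSpace ℝ (Fin m), (∀ i, z i ∈ Y) →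
        BayesianDuality.IsProbDensity (volume.restrict (Set.univ.pi fun _ => Y))
          (fun y => BayesianDuality.dualLikelihood Y ℓ γ y z)) ∧
      ∀ y : Fin n → EuclideanSpace ℝ (Fin m), (∀ i, y i ∈ Y) →
        BayesianDuality.marginalLikelihood Θ Y ℓ γ f x π y =
          BayesianDuality.dualMarginalLikelihood Θ Y ℓ γ (BayesianDuality.dataMap f x) π y := by
  set F := BayesianDuality.dataMap f x
  have hF : ∀ θ ∈ Θ, ContDiffAt ℝ 1 F θ := fun θ hθ =>
    contDiffAt_pi.2 fun i => (hf_smooth (x i)).contDiffAt hθ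
  have hFY : ∀ θ ∈ Θ, F θ ∈ Set.univ.pi fun _ : Fin n => Y := fun θ hθ i _ => hf_maps _ θ hθ
  obtain ⟨hm, hint⟩ := BayesianDuality.dualPrior_spec hd hΘ hF hπ_meas h_int
  have hone : ∫⁻ z, BayesianDuality.dualPrior Θ F π z = 1 := by
    have := hint (fun _ => 1) measurable_const
    simpa only [one_mul, hπ_one] using this
  have hzero : ∀ z, z ∉ (Set.univ.pi fun _ : Fin n => Y) →
      BayesianDuality.dualPrior Θ F π z = 0 := by
    intro z hz
    have : {θ | θ ∈ Θ ∧ F θ = z} = ∅ := by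
      ext θ
      simp only [Set.mem_ofPred_eq, Set.mem_empty_iff_false, iff_false]
      rintro ⟨hθ, rfl⟩
      exact hz (hFY θ hθ)
    rw [BayesianDuality.dualPrior, this, Measure.restrict_empty, lintegral_zero_measure]
  -- `π*` has mass one and vanishes off `𝒴ⁿ`, so `𝒴ⁿ` cannot be null; this keeps the Gibbs
  -- normalizers nonzero.
  have hvol : volume (Set.univ.pi fun _ : Fin n => Y) ≠ 0 := by
    intro h
    have h0 : ∫⁻ z, BayesianDuality.dualPrior Θ F π z = 0 := by
      rw [← lintegral_zero (μ := (volume : Measure (Fin n → EuclideanSpace ℝ (Fin m))))]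
      refine lintegral_congr_ae ?_
      filter_upwards [measure_eq_zero_iff_ae_notMem.1 h] with z hz
      exact hzero z hz
    rw [h0] at hone
    exact zero_ne_one hone
  refine ⟨⟨hm, hone⟩, fun z hz =>
    BayesianDuality.isProbDensity_dualLikelihood hY hℓ_cont h_gibbs hvol hz, fun y hy => ?_⟩
  have h := hint _ (BayesianDuality.measurable_indicator_dualLikelihood (γ := γ) hY hℓ_cont hy)
  rw [BayesianDuality.marginalLikelihood, BayesianDuality.dualMarginalLikelihood]
  calc _ = ∫⁻ θ in Θ, (Set.univ.pi fun _ : Fin n => Y).indicator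
        (BayesianDuality.dualLikelihood Y ℓ γ y) (F θ) * ENNReal.ofReal (π θ) := by
        refine setLIntegral_congr_fun hΘ fun θ hθ => ?_
        simp only [Set.indicator_of_mem (hFY θ hθ)]
        rw [← BayesianDuality.prod_gibbsLikelihood_eq_dualLikelihood h_gibbs hy
          fun i => hFY θ hθ i trivial]
        rfl
    _ = _ := h.symm
    _ = _ := by
        refine lintegral_congr fun z => ?_
        by_cases hz : z ∈ Set.univ.pi fun _ : Fin n => Y
        · rw [Set.indicator_of_mem hz]
        · rw [hzero z hz, mul_zero, mul_zero]
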